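/- Let $c=\sum_{v\in\mathbb{Z}^2}c_vX^v$ be a two-dimensional configuration, that is, a formal power series in two variables with exponents ranging over all of $\mathbb{Z}^2$ and coefficients in $\mathbb{C}$. For a Laurent polynomial $f=\sum_u a_uX^u\in\mathbb{C}[x^{\pm1},y^{\pm1}]$, let $fc$ be the configuration whose coefficient at $v\in\mathbb{Z}^2$ is $\sum_u a_u c_{v-u}$. Suppose that $c$ is integral (every coefficient $c_v$ is an integer) and finitary (the set $\{c_v : v\in\mathbb{Z}^2\}$ is finite), and that $c$ has a non-trivial annihilator, that is, there is a non-zero Laurent polynomial $f\in\mathbb{C}[x^{\pm1},y^{\pm1}]$ with $fc=0$. Then the ideal $$\mathrm{Ann}(c)=\{f\in\mathbb{C}[x,y] : fc=0\}$$ of $\mathbb{C}[x,y]$ is radical: if $g\in\mathbb{C}[x,y]$ and $g^n\in\mathrm{Ann}(c)$ for some integer $n\ge 0$, then $g\in\mathrm{Ann}(c)$. -/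

import Mathlib

/-- A `d`-dimensional configuration: a formal power series `∑ c_v X^v` with complex
coefficients, with exponents `v` ranging over all of `ℤ^d`. -/
abbrev SymbolicConfig (d : ℕ) : Type := (Fin d → ℤ) → ℂ

/-- Laurent polynomials in `d` variables over `ℂ`. -/
abbrev LaurentPoly (d : ℕ) : Type := AddMonoidAlgebra ℂ (Fin d → ℤ)

namespace SymbolicConfig

/-- All coefficients are integers. -/
def IsIntegral {d : ℕ} (c : SymbolicConfig d) : Prop :=
  ∀ v, ∃ n : ℤ, c v = (n : ℂ)

/-- Only finitely many distinct coefficients occur. -/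
def IsFinitary {d : ℕ} (c : SymbolicConfig d) : Prop :=
  (Set.range c).Finite

/-- The formal product `f c` of a Laurent polynomial `f = ∑ a_u X^u` and a configuration `c`:
its coefficient at `v` is the finite sum `∑_u a_u c_{v - u}`. -/
noncomputable def formalMul {d : ℕ} (f : LaurentPoly d) (c : SymbolicConfig d) :
    SymbolicConfig d :=
  fun v => f.coeff.sum fun u a => a * c (v - u)

/-- The Laurent polynomial `f` annihilates `c`, that is, `f c = 0`. -/
def Annihilates {d : ℕ} (f : LaurentPoly d) (c : SymbolicConfig d) : Prop :=
  formalMul f c = 0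

/-- An ordinary polynomial seen as a Laurent polynomial (`x_i` goes to `X^{e_i}`). -/
noncomputable def toLaurent (d : ℕ) : MvPolynomial (Fin d) ℂ →ₐ[ℂ] LaurentPoly d :=
  MvPolynomial.aeval fun i => AddMonoidAlgebra.single (Pi.single i (1 : ℤ)) (1 : ℂ)

theorem formalMul_zero_left {d : ℕ} (c : SymbolicConfig d) : formalMul 0 c = 0 := by
  funext v
  simp [formalMul]

theorem formalMul_zero_right {d : ℕ} (f : LaurentPoly d) : formalMul f 0 = 0 := by
  funext v
  simp [formalMul]

theorem formalMul_add_left {d : ℕ} (f g : LaurentPoly d) (c : SymbolicConfig d) :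
    formalMul (f + g) c = formalMul f c + formalMul g c := by
  funext v
  simp only [formalMul, Pi.add_apply]
  exact Finsupp.sum_add_index' (by simp) (by intros; ring)

theorem formalMul_add_right {d : ℕ} (f : LaurentPoly d) (c e : SymbolicConfig d) :
    formalMul f (c + e) = formalMul f c + formalMul f e := by
  funext v
  simp [formalMul, mul_add, Finsupp.sum_add]

theorem formalMul_single {d : ℕ} (u : Fin d → ℤ) (a : ℂ) (c : SymbolicConfig d)
    (v : Fin d → ℤ) : formalMul (AddMonoidAlgebra.single u a) c v = a * c (v - u) := by
  simp [formalMul]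

theorem formalMul_mul {d : ℕ} (f g : LaurentPoly d) (c : SymbolicConfig d) :
    formalMul (f * g) c = formalMul f (formalMul g c) := by
  induction f using AddMonoidAlgebra.induction_linear with
  | zero => simp [formalMul_zero_left]
  | add f₁ f₂ h₁ h₂ => rw [add_mul, formalMul_add_left, formalMul_add_left, h₁, h₂]
  | single u a =>
    induction g using AddMonoidAlgebra.induction_linear with
    | zero => simp [formalMul_zero_left, formalMul_zero_right]
    | add g₁ g₂ h₁ h₂ =>
      rw [mul_add, formalMul_add_left, formalMul_add_left, formalMul_add_right, h₁, h₂]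
    | single w b =>
      funext v
      rw [AddMonoidAlgebra.single_mul_single]
      simp only [formalMul_single]
      rw [mul_assoc, sub_sub]

/-- The annihilator ideal `Ann(c) = {f ∈ ℂ[x_1, …, x_d] | f c = 0}`. -/
noncomputable def Ann {d : ℕ} (c : SymbolicConfig d) : Ideal (MvPolynomial (Fin d) ℂ) where
  carrier := {f | Annihilates (toLaurent d f) c}
  zero_mem' := by
    simp [Annihilates, formalMul_zero_left]
  add_mem' := by
    intro f g hf hg
    simp only [Set.mem_ofPred_eq, Annihilates] at hf hg ⊢
    rw [map_add, formalMul_add_left, hf, hg, add_zero]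
  smul_mem' := by
    intro f g hg
    simp only [Set.mem_ofPred_eq, Annihilates] at hg ⊢
    rw [smul_eq_mul, map_mul, formalMul_mul, hg, formalMul_zero_right]

end SymbolicConfig

/-!
Let `c` be bounded and integral, with a nonzero annihilator. It has to be shown that `g ^ 2 • c = 0`
implies `g • c = 0`.

The arithmetic of the coefficients gives one explicit annihilator. There is an annihilator
`∑ a_u X^u` with integer coefficients (`exists_int_annihilator`). By the Frobenius congruence
`(∑ a_u X^u) ^ p ≡ ∑ a_u X^(pu) mod p`, the configuration `(∑ a_u X^(pu)) c` has coefficients that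
are divisible by `p` and bounded independently of `p`, so it vanishes for all large primes `p`
(`sum_mono_prime_nsmul_smul_eq_zero`). Iterating, `∑ a_u X^(nu)` kills `c` for all `n ≡ 1` modulo
some factorial, and a Vandermonde elimination yields a product of differences `X^x - X^y`, `x ≠ y`,
that kills `c` (`exists_prod_mono_sub_smul_eq_zero`).

The rest uses only that `c` is bounded. Call an operator `r` cancellable if `g • (r • c) = 0`
implies `g • c = 0` for all bounded `c` with `g ^ 2 • c = 0`. Cancellable operators are closed under
products, so it is enough that each `X^x - X^y` is cancellable (`mono_sub_mono_mem_cancel`). Since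
polynomials split over `ℂ`, this reduces to `X^w - z` with `w` primitive, that is, to the case in
which `e = g • c` is an eigenvector of `X^w`. Complete `w` to a basis `w`, `u` of `ℤ²` and reduce `g`
modulo `X^w - z` to a Laurent polynomial `q` in `X^u`, which kills `e`.
* If `q = 0`, then `e = (X^w - z) b` with `b` bounded, and `e` is killed by `X^w - z`.
* If `q ≠ 0`, splitting `q` reduces to the case in which `e` is an eigenvector of `X^u` too. Then all
  monomials act on `e` through a character, at which `g` vanishes because `g • e = 0`.

In both cases `e` is a sum of terms `(y - 1) • b`, where `b` is bounded and `y` is a translation,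
rescaled so as to fix `e`. Averaging over powers of the operators `y` leaves `e` unchanged and makes
these terms arbitrarily small, so `e = 0` (`eq_zero_of_eq_sum_sub_one_smul`).
-/

open Polynomial

namespace SymbolicConfig

/-! ### Configurations as a module over Laurent polynomials -/

section Module

variable {d : ℕ}

theorem formalMul_one (c : SymbolicConfig d) : formalMul 1 c = c := by
  funext v
  rw [AddMonoidAlgebra.one_def, formalMul_single, one_mul, sub_zero]

/-- Configurations form a module over the ring of Laurent polynomials under the formal product. -/
noncomputable instance instModuleLaurentPoly : Module (LaurentPoly d) (SymbolicConfig d) where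
  smul := formalMul
  one_smul := formalMul_one
  mul_smul := formalMul_mul
  smul_zero := formalMul_zero_right
  smul_add := formalMul_add_right
  add_smul := formalMul_add_left
  zero_smul := formalMul_zero_left

theorem smul_eq_formalMul (f : LaurentPoly d) (c : SymbolicConfig d) :
    f • c = formalMul f c := rfl

instance : IsScalarTower ℂ (LaurentPoly d) (SymbolicConfig d) :=
  IsScalarTower.of_algebraMap_smul fun a c => by
    funext v
    rw [smul_eq_formalMul, AddMonoidAlgebra.coe_algebraMap]
    simp [formalMul_single]

/-- The Laurent monomial `X^x`. -/
noncomputable def mono (x : Fin d → ℤ) : LaurentPoly d := AddMonoidAlgebra.single x 1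

theorem mono_zero : mono (0 : Fin d → ℤ) = 1 := rfl

theorem mono_add (x y : Fin d → ℤ) : mono (x + y) = mono x * mono y := by
  simp [mono, AddMonoidAlgebra.single_mul_single]

theorem mono_nsmul (n : ℕ) (x : Fin d → ℤ) : mono (n • x) = mono x ^ n := by
  simp [mono, AddMonoidAlgebra.single_pow]

theorem mono_neg_mul (x : Fin d → ℤ) : mono (-x) * mono x = 1 := by
  rw [← mono_add, neg_add_cancel, mono_zero]

theorem single_eq_smul_mono (x : Fin d → ℤ) (a : ℂ) :
    (AddMonoidAlgebra.single x a : LaurentPoly d) = a • mono x := by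
  simp [mono]

theorem mono_smul_apply (x : Fin d → ℤ) (c : SymbolicConfig d) (v : Fin d → ℤ) :
    (mono x • c) v = c (v - x) := by
  rw [smul_eq_formalMul, mono, formalMul_single, one_mul]

theorem sum_smul_mono (f : LaurentPoly d) :
    ∑ u ∈ f.coeff.support, f.coeff u • mono u = f := by
  simp_rw [← single_eq_smul_mono]
  exact AddMonoidAlgebra.sum_coeff_single f

/-- The submodule of bounded configurations. -/
def bounded (d : ℕ) : Submodule (LaurentPoly d) (SymbolicConfig d) where
  carrier := {c | ∃ C : ℝ, ∀ v, ‖c v‖ ≤ C}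
  zero_mem' := ⟨0, by simp⟩
  add_mem' := by
    rintro a b ⟨A, hA⟩ ⟨B, hB⟩
    exact ⟨A + B, fun v => (norm_add_le _ _).trans (add_le_add (hA v) (hB v))⟩
  smul_mem' := by
    rintro r c ⟨C, hC⟩
    induction r using AddMonoidAlgebra.induction_linear with
    | zero => exact ⟨0, by simp⟩
    | add f g hf hg =>
      obtain ⟨A, hA⟩ := hf
      obtain ⟨B, hB⟩ := hg
      refine ⟨A + B, fun v => ?_⟩
      rw [add_smul]
      exact (norm_add_le _ _).trans (add_le_add (hA v) (hB v))
    | single x a =>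
      refine ⟨‖a‖ * C, fun v => ?_⟩
      rw [smul_eq_formalMul, formalMul_single, norm_mul]
      exact mul_le_mul_of_nonneg_left (hC _) (norm_nonneg _)

theorem IsFinitary.mem_bounded {c : SymbolicConfig d} (hc : c.IsFinitary) : c ∈ bounded d := by
  obtain ⟨C, hC⟩ := hc.isBounded.exists_norm_le
  exact ⟨C, fun v => hC _ ⟨v, rfl⟩⟩

end Module

/-! ### Averaging bounded configurations -/

section Averaging

variable {d : ℕ}

/-- The Laurent polynomials whose action does not increase uniform bounds. -/
def contractions (d : ℕ) : Submonoid (LaurentPoly d) where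
  carrier := {r | ∀ (c : SymbolicConfig d) (C : ℝ), (∀ v, ‖c v‖ ≤ C) → ∀ v, ‖(r • c) v‖ ≤ C}
  one_mem' := fun c C h v => by simpa using h v
  mul_mem' := fun {r s} hr hs c C h v => by
    rw [mul_smul]
    exact hr _ _ (hs _ _ h) v

theorem smul_mono_mem_contractions {a : ℂ} (ha : ‖a‖ = 1) (x : Fin d → ℤ) :
    a • mono x ∈ contractions d := by
  intro c C h v
  rw [smul_assoc, Pi.smul_apply, mono_smul_apply, norm_smul, ha, one_mul]
  exact h _

/-- The averaging operator `(1 + y + ⋯ + y ^ (n - 1)) / n`. -/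
noncomputable def average (y : LaurentPoly d) (n : ℕ) : LaurentPoly d :=
  (n : ℂ)⁻¹ • ∑ k ∈ Finset.range n, y ^ k

theorem average_mem_contractions {y : LaurentPoly d} (hy : y ∈ contractions d) {n : ℕ}
    (hn : n ≠ 0) : average y n ∈ contractions d := by
  intro c C h v
  have hn' : (0 : ℝ) < n := by positivity
  rw [average, smul_assoc, Finset.sum_smul, Pi.smul_apply, Finset.sum_apply, norm_smul, norm_inv,
    Complex.norm_natCast, inv_mul_le_iff₀ hn']
  calc _ ≤ ∑ k ∈ Finset.range n, ‖(y ^ k • c) v‖ := norm_sum_le _ _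
    _ ≤ ∑ k ∈ Finset.range n, C := Finset.sum_le_sum fun k _ => pow_mem hy k _ _ h v
    _ = n * C := by simp

theorem average_smul_of_fixed {y : LaurentPoly d} {e : SymbolicConfig d} (h : y • e = e) {n : ℕ}
    (hn : n ≠ 0) : average y n • e = e := by
  have hk : ∀ k : ℕ, y ^ k • e = e := by
    intro k
    induction k with
    | zero => simp
    | succ k ih => rw [pow_succ, mul_smul, h, ih]
  rw [average, smul_assoc, Finset.sum_smul, Finset.sum_congr rfl fun k _ => hk k]
  funext v
  have : (n : ℂ) ≠ 0 := by exact_mod_cast hn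
  simp [this]

theorem norm_average_smul_sub_le {y : LaurentPoly d} (hy : y ∈ contractions d)
    {b : SymbolicConfig d} {C : ℝ} (hb : ∀ v, ‖b v‖ ≤ C) (n : ℕ) (v : Fin d → ℤ) :
    ‖(average y n • (y - 1) • b) v‖ ≤ (n : ℝ)⁻¹ * (2 * C) := by
  rw [← mul_smul, average, smul_mul_assoc, geom_sum_mul, smul_assoc, Pi.smul_apply, norm_smul,
    norm_inv, Complex.norm_natCast, sub_smul, one_smul, two_mul]
  refine mul_le_mul_of_nonneg_left ?_ (by positivity)
  exact (norm_sub_le _ _).trans (add_le_add (pow_mem hy n _ _ hb v) (hb v))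

/-- A sum of coboundaries `(y i - 1) • b i` of bounded configurations that is fixed by all the
contractions `y i` vanishes: averaging over powers of the `y i` fixes the sum, but makes it
arbitrarily small. -/
theorem eq_zero_of_eq_sum_sub_one_smul {ι : Type*} {s : Finset ι} {y : ι → LaurentPoly d}
    {b : ι → SymbolicConfig d} {e : SymbolicConfig d} (hy : ∀ i ∈ s, y i ∈ contractions d)
    (hye : ∀ i ∈ s, y i • e = e) (hb : ∀ i ∈ s, b i ∈ bounded d)
    (he : e = ∑ i ∈ s, (y i - 1) • b i) : e = 0 := by
  classical
  have key : ∀ t ⊆ s, ∀ ε > (0 : ℝ), ∃ r ∈ contractions d, r • e = e ∧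
      ∀ v, ‖(r • ∑ i ∈ t, (y i - 1) • b i) v‖ ≤ ε := by
    intro t
    induction t using Finset.induction_on with
    | empty =>
      exact fun _ ε hε => ⟨1, one_mem _, one_smul _ _, fun v => by simpa using hε.le⟩
    | insert i t hi ih =>
      intro hts ε hε
      have his : i ∈ s := hts (Finset.mem_insert_self _ _)
      obtain ⟨r, hr, hre, hrt⟩ :=
        ih (fun j hj => hts (Finset.mem_insert_of_mem hj)) (ε / 2) (half_pos hε)
      obtain ⟨C, hC⟩ := hb i his
      obtain ⟨n, hn⟩ := exists_nat_gt (2 * C / (ε / 2))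
      have hC0 : 0 ≤ C := (norm_nonneg _).trans (hC 0)
      have hn0 : (0 : ℝ) < n := lt_of_le_of_lt (by positivity) hn
      have hn1 : n ≠ 0 := by exact_mod_cast hn0.ne'
      have hA := average_mem_contractions (hy i his) hn1
      refine ⟨average (y i) n * r, mul_mem hA hr, ?_, fun v => ?_⟩
      · rw [mul_smul, hre, average_smul_of_fixed (hye i his) hn1]
      · rw [Finset.sum_insert hi, smul_add]
        refine (norm_add_le _ _).trans ?_
        rw [← add_halves ε]
        refine add_le_add ?_ ?_
        · rw [mul_comm, mul_smul]
          refine hr _ _ (fun v => (norm_average_smul_sub_le (hy i his) hC n v).trans ?_) v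
          rw [inv_mul_le_iff₀ hn0]
          rw [div_lt_iff₀ (half_pos hε)] at hn
          exact hn.le
        · rw [mul_smul]
          exact hA _ _ hrt v
  funext v
  refine norm_le_zero_iff.1 (le_of_forall_pos_le_add fun ε hε => ?_)
  obtain ⟨r, -, hre, hr⟩ := key s subset_rfl ε hε
  rw [← he, hre] at hr
  simpa using hr v

theorem norm_le_one_of_mono_smul_eq {e : SymbolicConfig d} (he : e ∈ bounded d) (h0 : e ≠ 0)
    {x : Fin d → ℤ} {z : ℂ} (h : mono x • e = z • e) : ‖z‖ ≤ 1 := by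
  obtain ⟨C, hC⟩ := he
  obtain ⟨v, hv⟩ := Function.ne_iff.1 h0
  have hpow : ∀ k : ℕ, mono x ^ k • e = z ^ k • e := by
    intro k
    induction k with
    | zero => simp
    | succ k ih => rw [pow_succ, mul_smul, h, smul_comm, ih, smul_smul, pow_succ']
  by_contra! hz
  obtain ⟨k, hk⟩ := pow_unbounded_of_one_lt (C / ‖e v‖) hz
  have hv' : 0 < ‖e v‖ := norm_pos_iff.2 hv
  rw [div_lt_iff₀ hv', ← norm_pow, ← norm_mul, ← smul_eq_mul, ← Pi.smul_apply, ← hpow,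
    ← mono_nsmul, mono_smul_apply] at hk
  exact (hC _).not_gt hk

theorem norm_eq_one_of_mono_smul_eq {e : SymbolicConfig d} (he : e ∈ bounded d) (h0 : e ≠ 0)
    {x : Fin d → ℤ} {z : ℂ} (h : mono x • e = z • e) : ‖z‖ = 1 := by
  have hz : z ≠ 0 := by
    rintro rfl
    apply h0
    rw [← one_smul (LaurentPoly d) e, ← mono_neg_mul x, mul_smul, h, zero_smul, smul_zero]
  have h' : mono (-x) • e = z⁻¹ • e := by
    rw [eq_inv_smul_iff₀ hz, smul_comm, ← h, ← mul_smul, mono_neg_mul, one_smul]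
  have h1 := norm_le_one_of_mono_smul_eq he h0 h'
  rw [norm_inv] at h1
  exact le_antisymm (norm_le_one_of_mono_smul_eq he h0 h)
    ((inv_le_one₀ (norm_pos_iff.2 hz)).1 h1)

end Averaging

/-! ### Operators that can be cancelled -/

section Cancel

variable {d : ℕ}

/-- The elements `r` that can be cancelled from `r • c ∈ K` for `c ∈ M`, that is, that act
injectively on the image of `M` in `F ⧸ K`. -/
def cancel {R F : Type*} [CommRing R] [AddCommGroup F] [Module R F] (M K : Submodule R F) :
    Submonoid R where
  carrier := {r | ∀ c ∈ M, r • c ∈ K → c ∈ K}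
  one_mem' := fun c _ h => by simpa using h
  mul_mem' := fun {r s} hr hs c hc h =>
    hs c hc (hr _ (M.smul_mem s hc) (by rwa [← mul_smul]))

/-- If every `t - z` can be cancelled, so can every nonzero polynomial in `t`, because it splits
over `ℂ`. -/
theorem aeval_mem_cancel {R F : Type*} [CommRing R] [Algebra ℂ R] [AddCommGroup F] [Module R F]
    {M K : Submodule R F} {t : R} (ht : ∀ z : ℂ, t - algebraMap ℂ R z ∈ cancel M K)
    {P : ℂ[X]} (hP : P ≠ 0) : aeval t P ∈ cancel M K := by
  rw [(IsAlgClosed.splits P).eq_prod_roots, map_mul, aeval_C, map_multiset_prod]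
  refine mul_mem (fun c _ h => ?_) (multiset_prod_mem _ fun x hx => ?_)
  · have hu : algebraMap ℂ R P.leadingCoeff⁻¹ * algebraMap ℂ R P.leadingCoeff = 1 := by
      rw [← map_mul, inv_mul_cancel₀ (leadingCoeff_ne_zero.2 hP), map_one]
    rw [← one_smul R c, ← hu, mul_smul]
    exact K.smul_mem _ h
  · simp only [Multiset.map_map, Multiset.mem_map] at hx
    obtain ⟨z, -, rfl⟩ := hx
    simpa using ht z

/-- The configurations killed by `g`. -/
def kernel (g : LaurentPoly d) : Submodule (LaurentPoly d) (SymbolicConfig d) where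
  carrier := {c | g • c = 0}
  zero_mem' := smul_zero _
  add_mem' := fun {a b} ha hb => by
    simp only [Set.mem_ofPred_eq] at ha hb ⊢
    rw [smul_add, ha, hb, add_zero]
  smul_mem' := fun r c hc => by
    simp only [Set.mem_ofPred_eq] at hc ⊢
    rw [smul_comm, hc, smul_zero]

theorem mem_kernel {g : LaurentPoly d} {c : SymbolicConfig d} : c ∈ kernel g ↔ g • c = 0 := Iff.rfl

theorem sub_algebraMap_smul_mem_kernel {g : LaurentPoly d} {c : SymbolicConfig d}
    {t : LaurentPoly d} {z : ℂ} :
    (t - algebraMap ℂ (LaurentPoly d) z) • c ∈ kernel g ↔ t • g • c = z • g • c := by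
  rw [mem_kernel, smul_comm, sub_smul, algebraMap_smul, sub_eq_zero]

/-- The bounded configurations killed by `g ^ 2`. -/
noncomputable def squareKernel (g : LaurentPoly d) : Submodule (LaurentPoly d) (SymbolicConfig d) :=
  bounded d ⊓ kernel (g ^ 2)

theorem smul_smul_eq_zero_of_mem_squareKernel {g : LaurentPoly d} {c : SymbolicConfig d}
    (hc : c ∈ squareKernel g) : g • g • c = 0 := by
  have := mem_kernel.1 hc.2
  rwa [pow_two, mul_smul] at this

end Cancel

/-! ### Eigenvectors of translations -/

section Eigen

variable {d : ℕ}

/-- The multiplicity of an eigenvalue of a translation acting on bounded configurations is one. -/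
theorem sub_smul_eq_zero_of_sq {b : SymbolicConfig d} (hb : b ∈ bounded d) {x : Fin d → ℤ} {z : ℂ}
    (h : mono x • (mono x - algebraMap ℂ (LaurentPoly d) z) • b =
      z • (mono x - algebraMap ℂ (LaurentPoly d) z) • b) :
    (mono x - algebraMap ℂ (LaurentPoly d) z) • b = 0 := by
  by_contra h0
  have hz := norm_eq_one_of_mono_smul_eq ((bounded d).smul_mem _ hb) h0 h
  have hz0 : z ≠ 0 := by
    rintro rfl
    simp at hz
  refine h0 (eq_zero_of_eq_sum_sub_one_smul (s := {()}) (y := fun _ => z⁻¹ • mono x)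
    (b := fun _ => algebraMap ℂ (LaurentPoly d) z • b) ?_ ?_ ?_ ?_)
  · exact fun _ _ => smul_mono_mem_contractions (by rw [norm_inv, hz, inv_one]) x
  · intro _ _
    rw [smul_assoc, h, inv_smul_smul₀ hz0]
  · exact fun _ _ => (bounded d).smul_mem _ hb
  · rw [Finset.sum_singleton, ← mul_smul, sub_mul, one_mul, smul_mul_assoc, mul_comm,
      ← Algebra.smul_def, inv_smul_smul₀ hz0]

/-- If all monomials act on `g • c` through scalars of modulus one and `g` kills `g • c`,
then `g • c = 0`: the value of `g` at the character by which the monomials act is zero, so `g • c`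
is a sum of coboundaries. -/
theorem smul_eq_zero_of_character {g : LaurentPoly d} {c : SymbolicConfig d} (hc : c ∈ bounded d)
    (hg : g • g • c = 0) {χ : (Fin d → ℤ) → ℂ} (hχ : ∀ x, ‖χ x‖ = 1)
    (he : ∀ x, mono x • g • c = χ x • g • c) : g • c = 0 := by
  by_contra h0
  have hχ0 : ∀ x, χ x ≠ 0 := fun x hx => by simpa [hx] using hχ x
  have hsum : ∑ u ∈ g.coeff.support, g.coeff u * χ u = 0 := by
    have h1 : (∑ u ∈ g.coeff.support, g.coeff u * χ u) • g • c = 0 := by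
      rw [Finset.sum_smul, ← hg]
      nth_rw 4 [← sum_smul_mono g]
      rw [Finset.sum_smul]
      exact Finset.sum_congr rfl fun u _ => by rw [mul_smul, smul_assoc, he]
    exact (smul_eq_zero.1 h1).resolve_right h0
  refine h0 (eq_zero_of_eq_sum_sub_one_smul (s := g.coeff.support)
    (y := fun u => (χ u)⁻¹ • mono u)
    (b := fun u => algebraMap ℂ (LaurentPoly d) (g.coeff u * χ u) • c) ?_ ?_ ?_ ?_)
  · exact fun u _ => smul_mono_mem_contractions (by rw [norm_inv, hχ, inv_one]) u
  · intro u _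
    rw [smul_assoc, he, inv_smul_smul₀ (hχ0 u)]
  · exact fun u _ => (bounded d).smul_mem _ hc
  · have hu : ∀ u, ((χ u)⁻¹ • mono u - 1) • algebraMap ℂ (LaurentPoly d) (g.coeff u * χ u) • c =
        (g.coeff u • mono u) • c - (g.coeff u * χ u) • c := by
      intro u
      rw [algebraMap_smul, sub_smul, one_smul, smul_comm, ← smul_assoc, smul_smul,
        mul_assoc, mul_inv_cancel₀ (hχ0 u), mul_one]
    rw [Finset.sum_congr rfl fun u _ => hu u, Finset.sum_sub_distrib, ← Finset.sum_smul,
      ← Finset.sum_smul, hsum, zero_smul, sub_zero, sum_smul_mono]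

/-- `X^(kw) ≡ z ^ k` modulo `X^w - z`, for negative `k` as well because `X^w` and `z` are units. -/
theorem mono_zsmul_sub_mem_span {z : ℂ} (hz : z ≠ 0) (w : Fin d → ℤ) (k : ℤ) :
    mono (k • w) - algebraMap ℂ (LaurentPoly d) (z ^ k) ∈
      Ideal.span {mono w - algebraMap ℂ (LaurentPoly d) z} := by
  have hnat : ∀ n : ℕ, mono ((n : ℤ) • w) - algebraMap ℂ (LaurentPoly d) (z ^ (n : ℤ)) ∈
      Ideal.span {mono w - algebraMap ℂ (LaurentPoly d) z} := by
    intro n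
    rw [Ideal.mem_span_singleton, natCast_zsmul, zpow_natCast, mono_nsmul, map_pow]
    exact sub_dvd_pow_sub_pow _ _ n
  obtain ⟨n, rfl | rfl⟩ := k.eq_nat_or_neg
  · exact hnat n
  · have h1 := mono_neg_mul ((n : ℤ) • w)
    have h2 : algebraMap ℂ (LaurentPoly d) (z ^ (-(n : ℤ))) *
        algebraMap ℂ (LaurentPoly d) (z ^ (n : ℤ)) = 1 := by
      rw [← map_mul, ← zpow_add₀ hz, neg_add_cancel, zpow_zero, map_one]
    have h3 := Ideal.mul_mem_left _
      (-(mono (-((n : ℤ) • w)) * algebraMap ℂ (LaurentPoly d) (z ^ (-(n : ℤ))))) (hnat n)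
    convert h3 using 1
    rw [neg_smul]
    linear_combination algebraMap ℂ (LaurentPoly d) (z ^ (-(n : ℤ))) * h1 -
      mono (-((n : ℤ) • w)) * h2

/-- The substitution `T ↦ X^u` of Laurent polynomials in one variable. -/
noncomputable def substMono (u : Fin d → ℤ) : LaurentPolynomial ℂ →ₐ[ℂ] LaurentPoly d :=
  AddMonoidAlgebra.mapDomainAlgHom ℂ ℂ (zmultiplesHom _ u)

theorem substMono_single (u : Fin d → ℤ) (k : ℤ) (a : ℂ) :
    substMono u (AddMonoidAlgebra.single k a) = a • mono (k • u) := by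
  rw [substMono, AddMonoidAlgebra.mapDomainAlgHom_apply, AddMonoidAlgebra.mapDomain_single,
    single_eq_smul_mono, zmultiplesHom_apply]

theorem substMono_toLaurent (u : Fin d → ℤ) (P : ℂ[X]) :
    substMono u (Polynomial.toLaurent P) = aeval (mono u) P := by
  have : (substMono u).comp Polynomial.toLaurentAlg = aeval (mono u) := by
    ext1
    rw [AlgHom.comp_apply, Polynomial.toLaurentAlg_apply, Polynomial.toLaurent_X, aeval_X,
      LaurentPolynomial.T, substMono_single, one_smul, one_smul]
  exact DFunLike.congr_fun this P

/-- If `w` and `u` span the exponents, then modulo `X^w - z` every Laurent polynomial is a Laurent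
polynomial in `X^u`. -/
theorem exists_sub_substMono_mem_span {w u : Fin d → ℤ} {α β : (Fin d → ℤ) → ℤ}
    (hαβ : ∀ x, x = α x • w + β x • u) {z : ℂ} (hz : z ≠ 0) (g : LaurentPoly d) :
    ∃ q, g - substMono u q ∈ Ideal.span {mono w - algebraMap ℂ (LaurentPoly d) z} := by
  induction g using AddMonoidAlgebra.induction_linear with
  | zero => exact ⟨0, by simp⟩
  | add f g hf hg =>
    obtain ⟨p, hp⟩ := hf
    obtain ⟨q, hq⟩ := hg
    refine ⟨p + q, ?_⟩
    rw [map_add, add_sub_add_comm]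
    exact add_mem hp hq
  | single x a =>
    refine ⟨AddMonoidAlgebra.single (β x) (a * z ^ α x), ?_⟩
    have h := Ideal.mul_mem_left _ (a • mono (β x • u)) (mono_zsmul_sub_mem_span hz w (α x))
    convert h using 1
    rw [substMono_single, single_eq_smul_mono]
    nth_rw 1 [hαβ x]
    rw [mono_add, Algebra.smul_def a, Algebra.smul_def (a * _), Algebra.smul_def a, map_mul]
    ring

theorem mono_zsmul_smul_eq {x : Fin d → ℤ} {z : ℂ} (hz : z ≠ 0) {e : SymbolicConfig d}
    (h : mono x • e = z • e) (k : ℤ) : mono (k • x) • e = z ^ k • e := by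
  obtain ⟨r, hr⟩ := Ideal.mem_span_singleton'.1 (mono_zsmul_sub_mem_span hz x k)
  rw [← sub_eq_zero, ← algebraMap_smul (LaurentPoly d) (z ^ k) e, ← sub_smul, ← hr, mul_smul,
    sub_smul, h, algebraMap_smul, sub_self, smul_zero]

/-- If `w` and `u` span the exponents, `c` is bounded, `g ^ 2 • c = 0` and `g • c` is an
eigenvector of `X^w`, then `g • c = 0`. Modulo `X^w - z`, the polynomial `g` is either zero, and
then a multiple eigenvalue would occur, or a nonzero Laurent polynomial in `X^u` that kills
`g • c`, and then `g • c` may be taken to be an eigenvector of `X^u` as well. -/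
theorem mono_sub_mem_cancel {w u : Fin d → ℤ} {α β : (Fin d → ℤ) → ℤ}
    (hαβ : ∀ x, x = α x • w + β x • u) (g : LaurentPoly d) (z : ℂ) :
    mono w - algebraMap ℂ (LaurentPoly d) z ∈ cancel (squareKernel g) (kernel g) := by
  intro c hc hK
  have hgc := smul_smul_eq_zero_of_mem_squareKernel hc
  rw [sub_algebraMap_smul_mem_kernel] at hK
  by_contra h0
  rw [mem_kernel] at h0
  have hz := norm_eq_one_of_mono_smul_eq ((bounded d).smul_mem g hc.1) h0 hK
  have hz0 : z ≠ 0 := by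
    rintro rfl
    simp at hz
  obtain ⟨q, hq⟩ := exists_sub_substMono_mem_span hαβ hz0 g
  obtain ⟨r, hr⟩ := Ideal.mem_span_singleton'.1 hq
  by_cases hq0 : q = 0
  · -- `g` is a multiple of `X^w - z`, so that `g • c` is killed by `X^w - z` and of the
    -- form `(X^w - z) • b`
    have hg : g • c = (mono w - algebraMap ℂ (LaurentPoly d) z) • r • c := by
      rw [← mul_smul, mul_comm, hr, hq0, map_zero, sub_zero]
    refine h0 (hg ▸ sub_smul_eq_zero_of_sq ((bounded d).smul_mem r hc.1) ?_)
    rw [← hg, hK]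
  · have hqe : substMono u q • g • c = 0 := by
      rw [← sub_sub_cancel g (substMono u q), ← hr, sub_smul, hgc, mul_smul, sub_smul, hK,
        algebraMap_smul, sub_self, smul_zero, sub_zero]
    obtain ⟨n, P, hP⟩ := q.exists_T_pow
    have hP0 : P ≠ 0 := by
      rintro rfl
      rw [map_zero, eq_comm] at hP
      exact hq0 ((LaurentPolynomial.isUnit_T _).mul_left_eq_zero.1 hP)
    have hPe : aeval (mono u) P • c ∈ kernel g := by
      rw [mem_kernel, smul_comm, ← substMono_toLaurent, hP, map_mul, mul_comm, mul_smul, hqe,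
        smul_zero]
    -- the configurations that satisfy what is known about `c` form a submodule
    let M := squareKernel g ⊓ kernel ((mono w - algebraMap ℂ (LaurentPoly d) z) * g)
    have hM : ∀ b ∈ M, mono w • g • b = z • g • b := by
      intro b hb
      have := mem_kernel.1 hb.2
      rwa [mul_smul, sub_smul, algebraMap_smul, sub_eq_zero] at this
    refine h0 (aeval_mem_cancel (M := M) (fun l b hb hl => ?_) hP0 c ⟨hc, ?_⟩ hPe)
    · rw [sub_algebraMap_smul_mem_kernel] at hl
      by_contra hb0
      rw [mem_kernel] at hb0
      have hl1 := norm_eq_one_of_mono_smul_eq ((bounded d).smul_mem g hb.1.1) hb0 hl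
      have hl0 : l ≠ 0 := by
        rintro rfl
        simp at hl1
      refine hb0 (smul_eq_zero_of_character hb.1.1 (smul_smul_eq_zero_of_mem_squareKernel hb.1)
        (χ := fun x => z ^ α x * l ^ β x) (fun x => by simp [hz, hl1]) fun x => ?_)
      nth_rw 1 [hαβ x]
      rw [mono_add, mul_smul, mono_zsmul_smul_eq hl0 hl, smul_comm, mono_zsmul_smul_eq hz0 (hM b hb),
        smul_smul, mul_comm]
    · refine mem_kernel.2 ?_
      rw [mul_smul, sub_smul, hK, algebraMap_smul, sub_self]

end Eigen

/-! ### Differences of monomials in the plane -/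

section Plane

/-- Every nonzero vector of `ℤ²` is a positive multiple of a member of a basis. -/
theorem exists_basis_of_ne_zero {v : Fin 2 → ℤ} (hv : v ≠ 0) :
    ∃ (n : ℕ) (w u : Fin 2 → ℤ) (α β : (Fin 2 → ℤ) → ℤ), n ≠ 0 ∧ v = n • w ∧
      ∀ x, x = α x • w + β x • u := by
  have hn : Int.gcd (v 0) (v 1) ≠ 0 := by
    intro h
    rw [Int.gcd_eq_zero_iff] at h
    refine hv (funext fun i => ?_)
    fin_cases i
    exacts [h.1, h.2]
  obtain ⟨p, hp⟩ := Int.gcd_dvd_left (v 0) (v 1)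
  obtain ⟨q, hq⟩ := Int.gcd_dvd_right (v 0) (v 1)
  have hb := Int.gcd_eq_gcd_ab (v 0) (v 1)
  set n := Int.gcd (v 0) (v 1)
  set s := Int.gcdA (v 0) (v 1)
  set t := Int.gcdB (v 0) (v 1)
  have hst : p * s + q * t = 1 := by
    have hn' : (n : ℤ) ≠ 0 := by exact_mod_cast hn
    apply mul_left_cancel₀ hn'
    linear_combination -hb - s * hp - t * hq
  refine ⟨n, ![p, q], ![-t, s], fun x => s * x 0 + t * x 1, fun x => p * x 1 - q * x 0, hn,
    funext fun i => ?_, fun x => funext fun i => ?_⟩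
  · fin_cases i
    · simpa using hp
    · simpa using hq
  · fin_cases i
    · simp
      linear_combination -x 0 * hst
    · simp
      linear_combination -x 1 * hst

/-- With `x - y = n • w` for a member `w` of a basis, `X^x - X^y` is, up to a unit, the polynomial
`T ^ n - 1` at `T = X^w`. -/
theorem mono_sub_mono_mem_cancel (g : LaurentPoly 2) {x y : Fin 2 → ℤ} (hxy : x ≠ y) :
    mono x - mono y ∈ cancel (squareKernel g) (kernel g) := by
  intro c hc h
  obtain ⟨n, w, u, α, β, hn, hv, hαβ⟩ := exists_basis_of_ne_zero (sub_ne_zero.2 hxy)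
  refine aeval_mem_cancel (mono_sub_mem_cancel hαβ g) (X_pow_sub_C_ne_zero hn.bot_lt 1) c hc ?_
  have : aeval (mono w) (X ^ n - C 1 : ℂ[X]) = mono (-y) * (mono x - mono y) := by
    rw [mul_sub, mono_neg_mul, ← mono_add, neg_add_eq_sub, hv, mono_nsmul]
    simp
  rw [this, mul_smul]
  exact Submodule.smul_mem _ _ h

end Plane

/-! ### Annihilators with integer coefficients -/

section Integral

variable {d : ℕ}

theorem sum_smul_mono_smul_apply (s : Finset (Fin d → ℤ)) (a : (Fin d → ℤ) → ℤ)
    (y : (Fin d → ℤ) → Fin d → ℤ) (c : SymbolicConfig d) (v : Fin d → ℤ) :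
    ((∑ u ∈ s, (a u : LaurentPoly d) * mono (y u)) • c) v = ∑ u ∈ s, (a u : ℂ) * c (v - y u) := by
  rw [Finset.sum_smul, Finset.sum_apply]
  refine Finset.sum_congr rfl fun u _ => ?_
  rw [mul_smul, Int.cast_smul_eq_zsmul, Pi.smul_apply, mono_smul_apply, zsmul_eq_mul]

/-- An integral configuration with a nonzero annihilator has one with integer coefficients: apply
to the coefficients of a given annihilator a `ℚ`-linear functional `ℂ → ℚ`, and clear
denominators. -/
theorem exists_int_annihilator {c : SymbolicConfig d} (hint : c.IsIntegral) {f : LaurentPoly d}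
    (hf : f ≠ 0) (hfc : f • c = 0) :
    ∃ (s : Finset (Fin d → ℤ)) (a : (Fin d → ℤ) → ℤ), (∃ u ∈ s, a u ≠ 0) ∧
      (∑ u ∈ s, (a u : LaurentPoly d) * mono u) • c = 0 := by
  obtain ⟨u₀, hu₀⟩ : ∃ u, f.coeff u ≠ 0 := by
    by_contra! h
    exact hf (by ext u; simpa using h u)
  obtain ⟨φ, hφ⟩ : ∃ φ : Module.Dual ℚ ℂ, φ (f.coeff u₀) ≠ 0 := by
    by_contra! h
    exact hu₀ ((Module.forall_dual_apply_eq_zero_iff ℚ _).1 h)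
  obtain ⟨⟨b, hb⟩, hbf⟩ := IsLocalization.exist_integer_multiples (nonZeroDivisors ℤ)
    f.coeff.support fun u => φ (f.coeff u)
  have hb0 : (b : ℚ) ≠ 0 := by exact_mod_cast nonZeroDivisors.ne_zero hb
  choose! a ha using hbf
  simp only [eq_intCast, zsmul_eq_mul] at ha
  refine ⟨f.coeff.support, a, ⟨u₀, Finsupp.mem_support_iff.2 hu₀, fun h0 => ?_⟩,
    funext fun v => ?_⟩
  · have := ha u₀ (Finsupp.mem_support_iff.2 hu₀)
    rw [h0, Int.cast_zero, eq_comm, mul_eq_zero] at this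
    exact this.elim hb0 hφ
  · choose n hn using hint
    have hv : ∑ u ∈ f.coeff.support, f.coeff u * c (v - u) = 0 := congrFun hfc v
    have hφv : ∑ u ∈ f.coeff.support, φ (f.coeff u) * (n (v - u) : ℚ) = 0 := by
      rw [← map_zero φ, ← hv, map_sum]
      refine Finset.sum_congr rfl fun u _ => ?_
      rw [hn, mul_comm (f.coeff u), ← zsmul_eq_mul, map_zsmul, zsmul_eq_mul, mul_comm]
    have hZ : ∑ u ∈ f.coeff.support, (a u : ℚ) * (n (v - u) : ℚ) = 0 := by
      rw [← mul_zero (b : ℚ), ← hφv, Finset.mul_sum]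
      exact Finset.sum_congr rfl fun u hu => by rw [ha u hu, mul_assoc]
    rw [sum_smul_mono_smul_apply, Pi.zero_apply]
    simp_rw [hn]
    exact_mod_cast hZ

/-- The Laurent polynomials that map integral configurations to integral ones. -/
def integralPreserving (d : ℕ) : Subring (LaurentPoly d) where
  carrier := {r | ∀ c : SymbolicConfig d, c.IsIntegral → (r • c).IsIntegral}
  one_mem' := fun c hc => by rwa [one_smul]
  zero_mem' := fun c _ v => ⟨0, by simp⟩
  mul_mem' := fun {r s} hr hs c hc => by
    rw [mul_smul]
    exact hr _ (hs _ hc)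
  add_mem' := fun {r s} hr hs c hc v => by
    obtain ⟨m, hm⟩ := hr c hc v
    obtain ⟨n, hn⟩ := hs c hc v
    exact ⟨m + n, by rw [add_smul, Pi.add_apply, hm, hn, Int.cast_add]⟩
  neg_mem' := fun {r} hr c hc v => by
    obtain ⟨m, hm⟩ := hr c hc v
    exact ⟨-m, by rw [neg_smul, Pi.neg_apply, hm, Int.cast_neg]⟩

theorem mono_mem_integralPreserving (x : Fin d → ℤ) : mono x ∈ integralPreserving d := by
  intro c hc v
  rw [mono_smul_apply]
  exact hc _

/-- The Frobenius congruence modulo a prime `p` for integer combinations. -/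
theorem exists_sum_pow_prime_eq {Q ι : Type*} [CommRing Q] {p : ℕ} (hp : p.Prime) (s : Finset ι)
    (a : ι → ℤ) (x : ι → Q) :
    ∃ h, (∑ u ∈ s, (a u : Q) * x u) ^ p = ∑ u ∈ s, (a u : Q) * x u ^ p + p * h := by
  classical
  induction s using Finset.induction_on with
  | empty => exact ⟨0, by simp [hp.ne_zero]⟩
  | insert i s hi ih =>
    obtain ⟨h, hh⟩ := ih
    obtain ⟨r, hr⟩ := exists_add_pow_prime_eq hp ((a i : Q) * x i) (∑ u ∈ s, (a u : Q) * x u)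
    obtain ⟨b, hb⟩ : ∃ b : ℤ, a i ^ p = a i + p * b := by
      have := Fact.mk hp
      have h1 : (p : ℤ) ∣ a i ^ p - a i := by
        rw [← ZMod.intCast_zmod_eq_zero_iff_dvd]
        push_cast
        rw [ZMod.pow_card, sub_self]
      obtain ⟨b, hb⟩ := h1
      exact ⟨b, by rw [← hb, add_sub_cancel]⟩
    have hb' : (a i : Q) ^ p = a i + p * b := by exact_mod_cast congrArg (Int.cast : ℤ → Q) hb
    refine ⟨b * x i ^ p + h + (a i * x i) * (∑ u ∈ s, (a u : Q) * x u) * r, ?_⟩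
    rw [Finset.sum_insert hi, Finset.sum_insert hi, hr, hh, mul_pow, hb']
    ring

/-- If `∑ a_u X^u` kills `c`, so does `∑ a_u X^(pu)` for every large prime `p`: by the Frobenius
congruence the resulting coefficients are divisible by `p`, and they are bounded independently
of `p`. -/
theorem sum_mono_prime_nsmul_smul_eq_zero {c : SymbolicConfig d} (hint : c.IsIntegral) {C : ℝ}
    (hC : ∀ v, ‖c v‖ ≤ C) {s : Finset (Fin d → ℤ)} {a : (Fin d → ℤ) → ℤ}
    {y : (Fin d → ℤ) → Fin d → ℤ}
    (h : (∑ u ∈ s, (a u : LaurentPoly d) * mono (y u)) • c = 0) {p : ℕ} (hp : p.Prime)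
    (hCp : ∑ u ∈ s, ‖(a u : ℂ)‖ * C < p) :
    (∑ u ∈ s, (a u : LaurentPoly d) * mono (p • y u)) • c = 0 := by
  obtain ⟨q, hq⟩ := exists_sum_pow_prime_eq hp s a
    fun u => (⟨mono (y u), mono_mem_integralPreserving _⟩ : integralPreserving d)
  have hq' := congrArg (Subring.subtype (integralPreserving d)) hq
  simp only [map_pow, map_add, map_sum, map_mul, map_intCast, map_natCast, Subring.subtype_apply,
    ← mono_nsmul] at hq'
  have hsum : (∑ u ∈ s, (a u : LaurentPoly d) * mono (p • y u)) • c =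
      -((p : LaurentPoly d) • (q : LaurentPoly d) • c) := by
    rw [eq_neg_iff_add_eq_zero, ← mul_smul, ← add_smul, ← hq', ← Nat.sub_one_add_one hp.ne_zero,
      pow_succ, mul_smul, h, smul_zero]
  funext v
  obtain ⟨m, hm⟩ := q.2 c hint v
  have hval : ((∑ u ∈ s, (a u : LaurentPoly d) * mono (p • y u)) • c) v = -(p * m : ℂ) := by
    rw [hsum, Pi.neg_apply, Nat.cast_smul_eq_nsmul, Pi.smul_apply, hm, nsmul_eq_mul]
  have hle : ‖((∑ u ∈ s, (a u : LaurentPoly d) * mono (p • y u)) • c) v‖ < p := by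
    rw [sum_smul_mono_smul_apply]
    refine (norm_sum_le _ _).trans_lt (lt_of_le_of_lt (Finset.sum_le_sum fun u _ => ?_) hCp)
    rw [norm_mul]
    exact mul_le_mul_of_nonneg_left (hC _) (norm_nonneg _)
  have hp0 : (0 : ℝ) < p := by exact_mod_cast hp.pos
  rw [hval, norm_neg, norm_mul, Complex.norm_natCast, mul_lt_iff_lt_one_right hp0,
    Complex.norm_intCast] at hle
  have hm0 : m = 0 := Int.abs_lt_one_iff.1 (by exact_mod_cast hle)
  rw [hval, hm0, Int.cast_zero, mul_zero, neg_zero, Pi.zero_apply]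

theorem exists_forall_smul_eq_zero {c : SymbolicConfig d} (hfin : c.IsFinitary)
    (hint : c.IsIntegral) {s : Finset (Fin d → ℤ)} {a : (Fin d → ℤ) → ℤ}
    (h : (∑ u ∈ s, (a u : LaurentPoly d) * mono u) • c = 0) :
    ∃ M : ℕ, ∀ n : ℕ, n ≠ 0 → (∀ p : ℕ, p.Prime → p ∣ n → M < p) →
      (∑ u ∈ s, (a u : LaurentPoly d) * mono (n • u)) • c = 0 := by
  obtain ⟨C, hC⟩ := hfin.mem_bounded
  obtain ⟨M, hM⟩ := exists_nat_ge (∑ u ∈ s, ‖(a u : ℂ)‖ * C)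
  refine ⟨M, fun n => ?_⟩
  induction n using induction_on_primes with
  | zero => exact fun h => (h rfl).elim
  | one => exact fun _ _ => by simpa using h
  | prime_mul p n hp ih =>
    intro h0 hpn
    simp_rw [mul_nsmul']
    refine sum_mono_prime_nsmul_smul_eq_zero hint hC
      (ih (right_ne_zero_of_mul h0) fun l hl hln => hpn l hl (hln.mul_left p)) hp
      (hM.trans_lt ?_)
    exact_mod_cast hpn p hp (dvd_mul_right p n)

/-- An integral finitary configuration with a nonzero annihilator is killed by a product of
differences of monomials. The annihilators `∑ a_u X^((1 + kr)u)`, `k ≥ 0`, say that the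
configurations `b_u = a_u X^u c` satisfy `∑ (X^(ru))^k b_u = 0`. As in a Vandermonde system, the
polynomial `∏ (T - X^(ru))` over `u ≠ u₀` eliminates all of them except `b_(u₀)`. -/
theorem exists_prod_mono_sub_smul_eq_zero {c : SymbolicConfig d} (hfin : c.IsFinitary)
    (hint : c.IsIntegral) {f : LaurentPoly d} (hf : f ≠ 0) (hfc : f • c = 0) :
    ∃ (s : Finset (Fin d → ℤ)) (x : Fin d → ℤ), x ∉ s ∧
      (∏ y ∈ s, (mono x - mono y)) • c = 0 := by
  classical
  obtain ⟨s, a, ⟨u₀, hu₀, ha₀⟩, hac⟩ := exists_int_annihilator hint hf hfc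
  obtain ⟨M, hM⟩ := exists_forall_smul_eq_zero hfin hint hac
  set r := M.factorial
  have hr0 : r ≠ 0 := M.factorial_ne_zero
  have hinj : Function.Injective fun u : Fin d → ℤ => r • u := nsmul_right_injective hr0
  -- the prime factors of `1 + k * M!` exceed `M`
  have hk : ∀ k : ℕ, (∑ u ∈ s, (a u : LaurentPoly d) * mono ((1 + k * r) • u)) • c = 0 := by
    refine fun k => hM _ (by positivity) fun p hp hpk => ?_
    by_contra! hle
    have h1 : p ∣ k * r := (hp.dvd_factorial.2 hle).mul_left k
    exact hp.one_lt.not_ge (Nat.le_of_dvd one_pos ((Nat.dvd_add_iff_left h1).2 hpk))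
  let P : (LaurentPoly d)[X] := ∏ y ∈ s.erase u₀, (X - C (mono (r • y)))
  have hP : ∀ t, P.eval t = ∏ y ∈ s.erase u₀, (t - mono (r • y)) := fun t => by
    simp [P, eval_prod]
  have hzero : (∑ u ∈ s, (a u : LaurentPoly d) * mono u * P.eval (mono (r • u))) • c = 0 := by
    have : ∑ u ∈ s, (a u : LaurentPoly d) * mono u * P.eval (mono (r • u)) =
        ∑ k ∈ Finset.range (P.natDegree + 1),
          P.coeff k * ∑ u ∈ s, (a u : LaurentPoly d) * mono ((1 + k * r) • u) := by
      simp_rw [eval_eq_sum_range, Finset.mul_sum]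
      rw [Finset.sum_comm]
      refine Finset.sum_congr rfl fun k _ => Finset.sum_congr rfl fun u _ => ?_
      rw [add_smul, one_smul, mono_add, mul_nsmul', mono_nsmul k]
      ring
    rw [this, Finset.sum_smul]
    exact Finset.sum_eq_zero fun k _ => by rw [mul_smul, hk, smul_zero]
  rw [Finset.sum_eq_single_of_mem u₀ hu₀ fun u hu hne => by
    rw [hP, Finset.prod_eq_zero (Finset.mem_erase.2 ⟨hne, hu⟩) (sub_self (mono (r • u))),
      mul_zero]] at hzero
  refine ⟨(s.erase u₀).image fun u => r • u, r • u₀, ?_, ?_⟩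
  · rw [Finset.mem_image]
    rintro ⟨y, hy, hyu⟩
    exact Finset.ne_of_mem_erase hy (hinj hyu)
  · rw [Finset.prod_image hinj.injOn, ← hP]
    rw [mul_assoc, mul_smul, Int.cast_smul_eq_zsmul, ← Int.cast_smul_eq_zsmul ℂ] at hzero
    have h1 := (smul_eq_zero.1 hzero).resolve_left (by exact_mod_cast ha₀)
    rw [← one_smul (LaurentPoly d) (eval _ P • c), ← mono_neg_mul u₀, mul_smul, ← mul_smul (mono u₀),
      h1, smul_zero]

end Integral

/-! ### Radicality of the annihilator -/

theorem ann_isRadical {c : SymbolicConfig 2} (hfin : c.IsFinitary) (hint : c.IsIntegral)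
    {f : LaurentPoly 2} (hf : f ≠ 0) (hfc : f • c = 0) : c.Ann.IsRadical := by
  obtain ⟨s, x, hx, h⟩ := exists_prod_mono_sub_smul_eq_zero hfin hint hf hfc
  rw [Ideal.isRadical_iff_pow_one_lt 2 one_lt_two]
  intro g hg
  have hc : c ∈ squareKernel (toLaurent 2 g) :=
    ⟨hfin.mem_bounded, mem_kernel.2 (by rw [← map_pow]; exact hg)⟩
  have hprod : ∏ y ∈ s, (mono x - mono y) ∈
      cancel (squareKernel (toLaurent 2 g)) (kernel (toLaurent 2 g)) :=
    prod_mem fun y hy => mono_sub_mono_mem_cancel _ fun hxy => hx (hxy ▸ hy)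
  exact hprod c hc (by rw [h]; exact zero_mem _)

end SymbolicConfig

theorem mainTheorem5 (c : SymbolicConfig 2) (hfin : c.IsFinitary) (hint : c.IsIntegral)
    (hann : ∃ f : LaurentPoly 2, f ≠ 0 ∧ SymbolicConfig.Annihilates f c) :
    c.Ann.IsRadical := by
  obtain ⟨f, hf, hfc⟩ := hann
  exact SymbolicConfig.ann_isRadical hfin hint hf hfc
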